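/- Let $G$ be a countable discrete amenable group, i.e. there are finite sets $\Phi_n\subseteq G$ with $|\Phi_n\cap\Phi_n g|/|\Phi_n|\to1$ for all $g\in G$. Let $m,r\ge 1$ and let $\chi:G^m\to\{1,\dots,r\}$ be an arbitrary finite colouring. **Definitions.** For a sequence $(x_n)_{n\in\mathbb N}$ in $G$ let $\mathbf{FP}_L(x_n)$ (resp. $\mathbf{FP}_R(x_n)$) be the set of all products $\prod_{n\in F}x_n$, $F\subseteq\mathbb N$ finite and nonempty, taken in decreasing (resp. increasing) order of the indices. A subset of $G$ is *left* (resp. *right*) *IP* if it contains some $\mathbf{FP}_L(x_n)$ (resp. $\mathbf{FP}_R(x_n)$), and *left* (resp. *right*) *IP\** if it meets every left (resp. right) IP set. Let $H$ be a group. $S\subseteq H$ is *right syndetic* if $H=\bigcup_{h\in K}h^{-1}S$ for some finite $K\subseteq H$, and *left syndetic* if $H=\bigcup_{h\in K}Sh^{-1}$ for some finite $K\subseteq H$. $T\subseteq H$ is *left thick* (resp. *right thick*) if for every finite $F\subseteq H$ there is $x\in H$ with $xF\subseteq T$ (resp. $Fx\subseteq T$). A family $\mathcal W$ of subsets of $H$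 is *partition regular* if, whenever $A\in\mathcal W$ is a finite union $A=C_1\cup\dots\cup C_n$, some $C_i$ contains a member of $\mathcal W$. A nonempty family $\mathcal W$ of subsets of $H$ with $\emptyset\notin\mathcal W$ has the *right van der Waerden property* if 1. for every $A\in\mathcal W$ there is a set $S\subseteq H$ that is right syndetic or left thick such that $\bigcap_{f\in F}Af^{-1}\in\mathcal W$ for every finite $F\subseteq S$; 2. $\mathcal W$ is partition regular; 3. $Ax\in\mathcal W$ for all $A\in\mathcal W$ and $x\in H$. It has the *left van der Waerden property* if the same holds with (1) and (3) replaced by their mirror images: for every $A\in\mathcal W$ there is a set $S\subseteq H$ that is left syndetic or right thick such that $\bigcap_{f\in F}f^{-1}A\in\mathcal W$ for every finite $F\subseteq S$; and $xA\in\mathcal W$ for all $A\in\mathcal W$ and $x\in H$. The group $G$ is a *right* (resp. *left*) *van der Waerden group* if for every $m\ge1$ there is a family of subsets of $G^m$ with the right (resp. left) van der Waerden property. Let $D_m(\chi)$ be the set of all $g\in G$ for which there is $(x_1,\dots,x_m)\in G^m$ such that the $m+1$ points $$(x_1,x_2,\dots,x_m),\ (x_1g,x_2,\dots,x_m),\ (x_1g,x_2g,x_3,\dots,x_m),\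 \dots,\ (x_1g,x_2g,\dots,x_mg)$$ all have the same colour under $\chi$, and let $S_m(\chi)$ be the set of all $g\in G$ for which there is $(x_1,\dots,x_m)\in G^m$ such that $(x_1,\dots,x_m),\ (gx_1,x_2,\dots,x_m),\ \dots,\ (gx_1,gx_2,\dots,gx_m)$ all have the same colour under $\chi$. **Theorem.** 1. If $G$ is a right van der Waerden group, then $D_m(\chi)$ is left IP\*. 2. If $G$ is a left van der Waerden group, then $S_m(\chi)$ is right IP\*. -/

import Mathlib

namespace VanDerWaerden

open Filter Topology

section Amenability

/-- A sequence of finite subsets of `G` is right Følner if `|Φₙ ∩ Φₙ g| / |Φₙ| → 1` for every `g`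
(in particular `Φₙ` is eventually nonempty, since `0 / 0 = 0`). -/
def IsRightFolner {G : Type*} [Group G] (Φ : ℕ → Set G) : Prop :=
  (∀ n, (Φ n).Finite) ∧
    ∀ g : G, Tendsto
      (fun n => ((Φ n ∩ (fun a => a * g) '' Φ n).ncard : ℝ) / ((Φ n).ncard : ℝ)) atTop (𝓝 1)

/-- Amenability of a countable discrete group, through right Følner sequences. -/
def IsAmenable (G : Type*) [Group G] : Prop :=
  ∃ Φ : ℕ → Set G, IsRightFolner Φ

end Amenability

section IPSets

variable {G : Type*} [Group G]

/-- The left finite product set: all products `x_{n₁} x_{n₂} ⋯ x_{nₖ}` with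
`n₁ > n₂ > ⋯ > nₖ`, `k ≥ 1`. -/
def FPL (x : ℕ → G) : Set G :=
  {y | ∃ F : Finset ℕ, F.Nonempty ∧ y = ((F.sort (· ≤ ·)).reverse.map x).prod}

/-- The right finite product set: all products `x_{n₁} x_{n₂} ⋯ x_{nₖ}` with
`n₁ < n₂ < ⋯ < nₖ`, `k ≥ 1`. -/
def FPR (x : ℕ → G) : Set G :=
  {y | ∃ F : Finset ℕ, F.Nonempty ∧ y = ((F.sort (· ≤ ·)).map x).prod}

def IsLeftIP (Y : Set G) : Prop := ∃ x : ℕ → G, FPL x ⊆ Y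

def IsRightIP (Y : Set G) : Prop := ∃ x : ℕ → G, FPR x ⊆ Y

def IsLeftIPStar (X : Set G) : Prop := ∀ Y : Set G, IsLeftIP Y → (X ∩ Y).Nonempty

def IsRightIPStar (X : Set G) : Prop := ∀ Y : Set G, IsRightIP Y → (X ∩ Y).Nonempty

end IPSets

section Largeness

variable {G : Type*} [Group G]

/-- `G = ⋃_{h ∈ H} h⁻¹ S` for some finite `H`. -/
def IsRightSyndetic (S : Set G) : Prop :=
  ∃ H : Finset G, Set.univ = ⋃ h ∈ H, (fun s => h⁻¹ * s) '' S

/-- `G = ⋃_{h ∈ H} S h⁻¹` for some finite `H`. -/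
def IsLeftSyndetic (S : Set G) : Prop :=
  ∃ H : Finset G, Set.univ = ⋃ h ∈ H, (fun s => s * h⁻¹) '' S

/-- Every finite `F` has a translate `F x` inside `T`. -/
def IsRightThick (T : Set G) : Prop :=
  ∀ F : Finset G, ∃ x : G, (fun f => f * x) '' (F : Set G) ⊆ T

/-- Every finite `F` has a translate `x F` inside `T`. -/
def IsLeftThick (T : Set G) : Prop :=
  ∀ F : Finset G, ∃ x : G, (fun f => x * f) '' (F : Set G) ⊆ T

/-- Whenever a member of `W` is cut into finitely many pieces, one of the pieces contains a
member of `W`. -/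
def IsPartitionRegular {X : Type*} (W : Set (Set X)) : Prop :=
  ∀ A ∈ W, ∀ (n : ℕ) (C : Fin n → Set X), A = ⋃ i, C i → ∃ i, ∃ B ∈ W, B ⊆ C i

end Largeness

section VdWFamilies

variable {G : Type*} [Group G]

/-- For every `A ∈ W` there is a right syndetic set, or a left thick set, all of whose finite
subsets `F` satisfy `⋂_{f ∈ F} A f⁻¹ ∈ W`. -/
def HasAlmostRightVdW (W : Set (Set G)) : Prop :=
  ∀ A ∈ W,
    (∃ S : Set G, IsRightSyndetic S ∧
      ∀ F : Finset G, (F : Set G) ⊆ S → (⋂ f ∈ F, (fun a => a * f⁻¹) '' A) ∈ W) ∨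
    (∃ T : Set G, IsLeftThick T ∧
      ∀ F : Finset G, (F : Set G) ⊆ T → (⋂ f ∈ F, (fun a => a * f⁻¹) '' A) ∈ W)

/-- For every `A ∈ W` there is a left syndetic set, or a right thick set, all of whose finite
subsets `F` satisfy `⋂_{f ∈ F} f⁻¹ A ∈ W`. -/
def HasAlmostLeftVdW (W : Set (Set G)) : Prop :=
  ∀ A ∈ W,
    (∃ S : Set G, IsLeftSyndetic S ∧
      ∀ F : Finset G, (F : Set G) ⊆ S → (⋂ f ∈ F, (fun a => f⁻¹ * a) '' A) ∈ W) ∨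
    (∃ T : Set G, IsRightThick T ∧
      ∀ F : Finset G, (F : Set G) ⊆ T → (⋂ f ∈ F, (fun a => f⁻¹ * a) '' A) ∈ W)

structure HasRightVdW (W : Set (Set G)) : Prop where
  nonempty : W.Nonempty
  empty_notMem : ∅ ∉ W
  almost : HasAlmostRightVdW W
  partitionRegular : IsPartitionRegular W
  translate : ∀ A ∈ W, ∀ x : G, (fun a => a * x) '' A ∈ W

structure HasLeftVdW (W : Set (Set G)) : Prop where
  nonempty : W.Nonempty
  empty_notMem : ∅ ∉ W
  almost : HasAlmostLeftVdW W
  partitionRegular : IsPartitionRegular W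
  translate : ∀ A ∈ W, ∀ x : G, (fun a => x * a) '' A ∈ W

/-- Each power `G^m` (`m ≥ 1`) carries a family of subsets with the right van der Waerden property.
(Countability and amenability of `G` are stated separately.) -/
def IsRightVdWGroup (G : Type*) [Group G] : Prop :=
  ∀ m : ℕ, 1 ≤ m → ∃ W : Set (Set (Fin m → G)), HasRightVdW W

/-- Each power `G^m` (`m ≥ 1`) carries a family of subsets with the left van der Waerden property.
(Countability and amenability of `G` are stated separately.) -/
def IsLeftVdWGroup (G : Type*) [Group G] : Prop :=
  ∀ m : ℕ, 1 ≤ m → ∃ W : Set (Set (Fin m → G)), HasLeftVdW W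

end VdWFamilies

section Corners

variable {G : Type*} [Group G] {m : ℕ}

/-- Right multiplication by `g` on the `j`-th component. -/
def mulRightAt (g : G) (j : Fin m) (x : Fin m → G) : Fin m → G :=
  Function.update x j (x j * g)

/-- Left multiplication by `g` on the `j`-th component. -/
def mulLeftAt (g : G) (j : Fin m) (x : Fin m → G) : Fin m → G :=
  Function.update x j (g * x j)

/-- With `R_j = mulRightAt g j` and `js = [j₁, …, jₖ]`, the set
`{x, R_{j₁} x, R_{j₁} R_{j₂} x, …, R_{j₁} ⋯ R_{jₖ} x}`. -/
def rightCorner (x : Fin m → G) (g : G) (js : List (Fin m)) : Set (Fin m → G) :=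
  {y | ∃ i ≤ js.length, y = (js.take i).foldr (mulRightAt g) x}

/-- With `L_j = mulLeftAt g j` and `js = [j₁, …, jₖ]`, the set
`{x, L_{j₁} x, L_{j₁} L_{j₂} x, …, L_{j₁} ⋯ L_{jₖ} x}`. -/
def leftCorner (x : Fin m → G) (g : G) (js : List (Fin m)) : Set (Fin m → G) :=
  {y | ∃ i ≤ js.length, y = (js.take i).foldr (mulLeftAt g) x}

/-- `D_k(χ)`: those `g` for which some right corner in the first `k` coordinates is
monochromatic. -/
def D {r : ℕ} (k : ℕ) (χ : (Fin m → G) → Fin r) : Set G :=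
  {g | ∃ c : Fin r, ∃ x : Fin m → G, rightCorner x g ((List.finRange m).take k) ⊆ χ ⁻¹' {c}}

/-- `S_k(χ)`: those `g` for which some left corner in the first `k` coordinates is
monochromatic. -/
def S {r : ℕ} (k : ℕ) (χ : (Fin m → G) → Fin r) : Set G :=
  {g | ∃ c : Fin r, ∃ x : Fin m → G, leftCorner x g ((List.finRange m).take k) ⊆ χ ⁻¹' {c}}

end Corners

end VanDerWaerden

namespace VanDerWaerden

/-- The product of `x n` over `n ∈ F`, in decreasing order of the indices. -/
def decreasingProd {G : Type*} [Group G] (x : ℕ → G) (F : Finset ℕ) : G :=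
  ((F.sort (· ≤ ·)).reverse.map x).prod

theorem sort_union_of_lt {F₁ F₂ : Finset ℕ} (h : ∀ a ∈ F₁, ∀ b ∈ F₂, a < b) :
    (F₁ ∪ F₂).sort (· ≤ ·) = F₁.sort (· ≤ ·) ++ F₂.sort (· ≤ ·) := by
  have hdisj : Disjoint F₁ F₂ :=
    Finset.disjoint_left.2 fun a h₁ h₂ => lt_irrefl a (h a h₁ a h₂)
  have hsorted : (F₁.sort (· ≤ ·) ++ F₂.sort (· ≤ ·)).Pairwise (· ≤ ·) := by
    refine List.pairwise_append.2 ⟨F₁.pairwise_sort _, F₂.pairwise_sort _, fun a ha b hb => ?_⟩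
    exact (h a (by simpa using ha) b (by simpa using hb)).le
  have hnodup : (F₁.sort (· ≤ ·) ++ F₂.sort (· ≤ ·)).Nodup := by
    refine List.nodup_append.2 ⟨F₁.sort_nodup _, F₂.sort_nodup _, fun a ha b hb => ?_⟩
    exact (h a (by simpa using ha) b (by simpa using hb)).ne
  refine List.Perm.eq_of_pairwise' ((F₁ ∪ F₂).pairwise_sort _) hsorted ?_
  refine (List.perm_ext_iff_of_nodup ((F₁ ∪ F₂).sort_nodup _) hnodup).2 fun a => ?_
  simp

theorem decreasingProd_union {G : Type*} [Group G] (x : ℕ → G) {F₁ F₂ : Finset ℕ}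
    (h : ∀ a ∈ F₁, ∀ b ∈ F₂, a < b) :
    decreasingProd x (F₁ ∪ F₂) = decreasingProd x F₂ * decreasingProd x F₁ := by
  simp [decreasingProd, sort_union_of_lt h]

/-- The element `(g, …, g, 1, …, 1)` of `G^m` with `i` entries `g`. -/
def initialDiag {G : Type*} [Group G] (m i : ℕ) (g : G) : Fin m → G :=
  fun j => if (j : ℕ) < i then g else 1

section InitialDiag

variable {G : Type*} [Group G]

theorem initialDiag_mul (m i : ℕ) (g h : G) :
    initialDiag m i (g * h) = initialDiag m i g * initialDiag m i h := by
  funext j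
  by_cases hj : (j : ℕ) < i <;> simp [initialDiag, hj]

theorem initialDiag_zero (m : ℕ) (g : G) : initialDiag m 0 g = 1 := by
  funext j
  simp [initialDiag]

theorem initialDiag_succ (m i : ℕ) (g : G) :
    initialDiag (m + 1) (i + 1) g = Fin.cons g (initialDiag m i g) := by
  funext j
  refine Fin.cases ?_ (fun j => ?_) j <;> simp [initialDiag]

theorem cons_mul_cons {m : ℕ} (a b : G) (x y : Fin m → G) :
    (Fin.cons a x : Fin (m + 1) → G) * (Fin.cons b y : Fin (m + 1) → G)
      = (Fin.cons (a * b) (x * y) : Fin (m + 1) → G) := by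
  funext j
  refine Fin.cases ?_ (fun j => ?_) j <;> simp

theorem mem_take_finRange {m i : ℕ} (j : Fin m) :
    j ∈ (List.finRange m).take i ↔ (j : ℕ) < i := by
  rw [List.mem_take_iff_getElem]
  constructor
  · rintro ⟨k, hk, rfl⟩
    simp at hk ⊢
    omega
  · intro h
    exact ⟨j, by simp [h], by simp⟩

theorem foldr_mulRightAt (g : G) {m : ℕ} (x : Fin m → G) (js : List (Fin m)) (hjs : js.Nodup)
    (j : Fin m) : js.foldr (mulRightAt g) x j = if j ∈ js then x j * g else x j := by
  induction js with
  | nil => simp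
  | cons a l ih =>
    obtain ⟨ha, hl⟩ := List.nodup_cons.1 hjs
    rcases eq_or_ne j a with rfl | hja
    · simp [mulRightAt, ih hl, ha]
    · simp [mulRightAt, ih hl, hja]

theorem foldr_mulLeftAt (g : G) {m : ℕ} (x : Fin m → G) (js : List (Fin m)) (hjs : js.Nodup)
    (j : Fin m) : js.foldr (mulLeftAt g) x j = if j ∈ js then g * x j else x j := by
  induction js with
  | nil => simp
  | cons a l ih =>
    obtain ⟨ha, hl⟩ := List.nodup_cons.1 hjs
    rcases eq_or_ne j a with rfl | hja
    · simp [mulLeftAt, ih hl, ha]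
    · simp [mulLeftAt, ih hl, hja]

theorem mem_D_iff {m r : ℕ} (χ : (Fin m → G) → Fin r) (g : G) :
    g ∈ D m χ ↔ ∃ c, ∃ y : Fin m → G, ∀ i ≤ m, χ (y * initialDiag m i g) = c := by
  have key (y : Fin m → G) (i : ℕ) :
      ((List.finRange m).take i).foldr (mulRightAt g) y = y * initialDiag m i g := by
    funext j
    rw [foldr_mulRightAt g y _ ((List.nodup_finRange m).sublist (List.take_sublist _ _))]
    by_cases hj : (j : ℕ) < i <;> simp [mem_take_finRange, initialDiag, hj]
  have htake : (List.finRange m).take m = List.finRange m := List.take_of_length_le (by simp)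
  simp only [D, rightCorner, htake, key, List.length_finRange, Set.mem_ofPred_eq]
  refine exists_congr fun c => exists_congr fun y => ⟨fun h i hi => h ⟨i, hi, rfl⟩, ?_⟩
  rintro h _ ⟨i, hi, rfl⟩
  exact h i hi

theorem mem_S_iff {m r : ℕ} (χ : (Fin m → G) → Fin r) (g : G) :
    g ∈ S m χ ↔ ∃ c, ∃ y : Fin m → G, ∀ i ≤ m, χ (initialDiag m i g * y) = c := by
  have key (y : Fin m → G) (i : ℕ) :
      ((List.finRange m).take i).foldr (mulLeftAt g) y = initialDiag m i g * y := by
    funext j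
    rw [foldr_mulLeftAt g y _ ((List.nodup_finRange m).sublist (List.take_sublist _ _))]
    by_cases hj : (j : ℕ) < i <;> simp [mem_take_finRange, initialDiag, hj]
  have htake : (List.finRange m).take m = List.finRange m := List.take_of_length_le (by simp)
  simp only [S, leftCorner, htake, key, List.length_finRange, Set.mem_ofPred_eq]
  refine exists_congr fun c => exists_congr fun y => ⟨fun h i hi => h ⟨i, hi, rfl⟩, ?_⟩
  rintro h _ ⟨i, hi, rfl⟩
  exact h i hi

end InitialDiag

section Families

variable {H : Type*} [Group H]

theorem iInter_image_mul_inv (F : Finset H) (A : Set H) :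
    (⋂ f ∈ F, (fun a => a * f⁻¹) '' A) = {y | ∀ f ∈ F, y * f ∈ A} := by
  ext y
  simp

theorem iInter_image_inv_mul (F : Finset H) (A : Set H) :
    (⋂ f ∈ F, (fun a => f⁻¹ * a) '' A) = {y | ∀ f ∈ F, f * y ∈ A} := by
  ext y
  simp

theorem isRightSyndetic_iff (S : Set H) :
    IsRightSyndetic S ↔ ∃ K : Finset H, ∀ z, ∃ h ∈ K, h * z ∈ S := by
  simp [IsRightSyndetic, Set.ext_iff]

theorem isLeftSyndetic_iff (S : Set H) :
    IsLeftSyndetic S ↔ ∃ K : Finset H, ∀ z, ∃ h ∈ K, z * h ∈ S := by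
  simp [IsLeftSyndetic, Set.ext_iff]

theorem isLeftThick_iff (T : Set H) :
    IsLeftThick T ↔ ∀ F : Finset H, ∃ z, ∀ f ∈ F, z * f ∈ T := by
  simp only [IsLeftThick, Set.subset_def, Set.forall_mem_image, Finset.mem_coe]

theorem isRightThick_iff (T : Set H) :
    IsRightThick T ↔ ∀ F : Finset H, ∃ z, ∀ f ∈ F, f * z ∈ T := by
  simp only [IsRightThick, Set.subset_def, Set.forall_mem_image, Finset.mem_coe]

theorem HasRightVdW.preimage_mul_mem {W : Set (Set H)} (hW : HasRightVdW W) {A : Set H}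
    (hA : A ∈ W) (t : H) : {y | y * t ∈ A} ∈ W := by
  simpa [Set.preimage] using hW.translate A hA t⁻¹

theorem HasRightVdW.exists_monochromatic {W : Set (Set H)} (hW : HasRightVdW W) {A : Set H}
    (hA : A ∈ W) {κ : Type*} [Finite κ] (χ : H → κ) :
    ∃ c, ∃ B ∈ W, B ⊆ A ∧ ∀ y ∈ B, χ y = c := by
  obtain ⟨n, ⟨e⟩⟩ := Finite.exists_equiv_fin κ
  obtain ⟨i, B, hB, hBi⟩ := hW.partitionRegular A hA n (fun i => {y | y ∈ A ∧ e (χ y) = i})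
    (by ext y; simp)
  exact ⟨e.symm i, B, hB, fun y hy => (hBi hy).1, fun y hy => by simp [← (hBi hy).2]⟩

/-- An anti-isomorphism carries the left van der Waerden property to the right one. -/
theorem HasLeftVdW.hasRightVdW_of_antiEquiv {H' : Type*} [Group H'] (e : H ≃ H')
    (he : ∀ a b, e (a * b) = e b * e a) {W : Set (Set H)} (hW : HasLeftVdW W) :
    HasRightVdW {A : Set H' | e ⁻¹' A ∈ W} := by
  classical
  have hsymm (a b : H') : e.symm (a * b) = e.symm b * e.symm a := by
    apply e.injective
    simp [he]
  have hinter (A : Set H') (F : Finset H') :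
      e ⁻¹' (⋂ f ∈ F, (fun a => a * f⁻¹) '' A)
        = ⋂ f ∈ F.image e.symm, (fun a => f⁻¹ * a) '' (e ⁻¹' A) := by
    rw [iInter_image_mul_inv, iInter_image_inv_mul]
    ext y
    simp [he]
  have hsub {S : Set H} {F : Finset H'} (hF : (F : Set H') ⊆ e.symm ⁻¹' S) :
      (F.image e.symm : Set H) ⊆ S := by
    intro a ha
    obtain ⟨f, hf, rfl⟩ := Finset.mem_image.1 (Finset.mem_coe.1 ha)
    exact hF (Finset.mem_coe.2 hf)
  refine ⟨?_, ?_, fun A hA => ?_, fun A hA n C hC => ?_, fun A hA t => ?_⟩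
  · obtain ⟨A, hA⟩ := hW.nonempty
    exact ⟨e.symm ⁻¹' A, by simpa [← Set.preimage_comp] using hA⟩
  · simpa using hW.empty_notMem
  · refine (hW.almost _ hA).imp ?_ ?_
    · rintro ⟨S, hS, hSW⟩
      refine ⟨e.symm ⁻¹' S, ?_, fun F hF => ?_⟩
      · rw [isLeftSyndetic_iff] at hS
        rw [isRightSyndetic_iff]
        obtain ⟨K, hK⟩ := hS
        refine ⟨K.image e, fun z => ?_⟩
        obtain ⟨h, hh, hz⟩ := hK (e.symm z)
        exact ⟨e h, Finset.mem_image_of_mem _ hh, by simpa [hsymm] using hz⟩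
      · rw [Set.mem_ofPred_eq, hinter]
        exact hSW _ (hsub hF)
    · rintro ⟨T, hT, hTW⟩
      refine ⟨e.symm ⁻¹' T, ?_, fun F hF => ?_⟩
      · rw [isRightThick_iff] at hT
        rw [isLeftThick_iff]
        intro F
        obtain ⟨z, hz⟩ := hT (F.image e.symm)
        refine ⟨e z, fun f hf => ?_⟩
        simpa [hsymm] using hz _ (Finset.mem_image_of_mem e.symm hf)
      · rw [Set.mem_ofPred_eq, hinter]
        exact hTW _ (hsub hF)
  · obtain ⟨i, B, hB, hBi⟩ := hW.partitionRegular _ hA n (fun i => e ⁻¹' C i)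
      (by rw [hC, Set.preimage_iUnion])
    refine ⟨i, e.symm ⁻¹' B, by simpa [← Set.preimage_comp] using hB, fun y hy => ?_⟩
    simpa using hBi hy
  · have : e ⁻¹' ((fun a => a * t) '' A) = (fun a => e.symm t * a) '' (e ⁻¹' A) := by
      have hinv : e (e.symm t)⁻¹ = t⁻¹ := by
        have h1 : e 1 = 1 := by simpa using he 1 1
        refine eq_inv_of_mul_eq_one_right ?_
        have := he (e.symm t)⁻¹ (e.symm t)
        simpa [h1] using this.symm
      ext y
      simp [he, hinv]
    rw [Set.mem_ofPred_eq, this]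
    exact hW.translate _ hA _

end Families

section MonochromaticCorners

variable {G : Type*} [Group G]

/-- If corners in `G^m` are partition regular along `x`, every member of a right van der Waerden
family on `G^(m+1)` contains the non-apex vertices of many corners with a common difference. -/
theorem HasRightVdW.exists_vertices_mem {m : ℕ} {W : Set (Set (Fin (m + 1) → G))}
    (hW : HasRightVdW W) (x : ℕ → G)
    (ih : ∀ (κ : Type) [Finite κ] (χ : (Fin m → G) → κ) (N : ℕ),
      ∃ F : Finset ℕ, F.Nonempty ∧ (∀ n ∈ F, N ≤ n) ∧
        ∃ c, ∃ y, ∀ i ≤ m, χ (y * initialDiag m i (decreasingProd x F)) = c)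
    {A : Set (Fin (m + 1) → G)} (hA : A ∈ W) (N : ℕ) :
    ∃ F : Finset ℕ, F.Nonempty ∧ (∀ n ∈ F, N ≤ n) ∧
      {y | ∀ i ≤ m, y * initialDiag (m + 1) (i + 1) (decreasingProd x F) ∈ A} ∈ W := by
  classical
  let v (i : ℕ) (g : G) : Fin (m + 1) → G := Fin.cons 1 (initialDiag m i g)
  obtain ⟨S, hSW, F, hF, hFN, h, hh⟩ : ∃ S : Set (Fin (m + 1) → G),
      (∀ E : Finset (Fin (m + 1) → G), (E : Set (Fin (m + 1) → G)) ⊆ S →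
        (⋂ f ∈ E, (fun a => a * f⁻¹) '' A) ∈ W) ∧
      ∃ F : Finset ℕ, F.Nonempty ∧ (∀ n ∈ F, N ≤ n) ∧
        ∃ h, ∀ i ≤ m, h * v i (decreasingProd x F) ∈ S := by
    rcases hW.almost A hA with ⟨S, hS, hSW⟩ | ⟨T, hT, hTW⟩
    · obtain ⟨K, hK⟩ := (isRightSyndetic_iff S).1 hS
      choose k hk hkS using hK
      obtain ⟨F, hF, hFN, c, y, hy⟩ :=
        ih (Fin K.card) (fun z => K.equivFin ⟨k (Fin.cons 1 z), hk (Fin.cons 1 z)⟩) N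
      refine ⟨S, hSW, F, hF, hFN, (K.equivFin.symm c : Fin (m + 1) → G) * Fin.cons 1 y, fun i hi => ?_⟩
      rw [mul_assoc, cons_mul_cons, mul_one, ← hy i hi, Equiv.symm_apply_apply]
      exact hkS _
    · obtain ⟨z, hz⟩ := (isLeftThick_iff T).1 hT
        ((Finset.range (m + 1)).image fun i => v i (decreasingProd x {N}))
      refine ⟨T, hTW, {N}, by simp, by simp, z, fun i hi => hz _ ?_⟩
      exact Finset.mem_image_of_mem _ (Finset.mem_range.2 (by omega))
  refine ⟨F, hF, hFN, ?_⟩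
  set g := decreasingProd x F
  have hB := hSW ((Finset.range (m + 1)).image fun i => h * v i g) (by
    intro f hf
    obtain ⟨i, hi, rfl⟩ := by simpa using hf
    exact hh i (by omega))
  rw [iInter_image_mul_inv] at hB
  convert hW.preimage_mul_mem hB ((Fin.cons g 1 : Fin (m + 1) → G) * h⁻¹) using 1
  have hvert (i : ℕ) : (Fin.cons g 1 : Fin (m + 1) → G) * v i g
      = initialDiag (m + 1) (i + 1) g := by
    rw [cons_mul_cons, initialDiag_succ, mul_one, one_mul]
  ext y
  simp [mul_assoc, hvert]

/-- Colour focusing: monochromatic corners with difference in a given left finite product set. -/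
theorem IsRightVdWGroup.exists_monochromatic_corner (hG : IsRightVdWGroup G) (x : ℕ → G) (m : ℕ)
    (κ : Type) [Finite κ] (χ : (Fin m → G) → κ) (N : ℕ) :
    ∃ F : Finset ℕ, F.Nonempty ∧ (∀ n ∈ F, N ≤ n) ∧
      ∃ c, ∃ y, ∀ i ≤ m, χ (y * initialDiag m i (decreasingProd x F)) = c := by
  classical
  induction m generalizing κ N with
  | zero =>
    refine ⟨{N}, by simp, by simp, χ 1, 1, fun i _ => ?_⟩
    congr 1
    exact Subsingleton.elim _ _
  | succ m ih =>
    have := Fintype.ofFinite κ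
    obtain ⟨W, hW⟩ := hG (m + 1) (by omega)
    by_contra hcon
    have focus (k : ℕ) : ∃ C : Finset κ, C.card = k ∧ ∃ M, N ≤ M ∧ ∃ A ∈ W,
        ∀ c ∈ C, ∃ F : Finset ℕ, F.Nonempty ∧ (∀ n ∈ F, N ≤ n ∧ n < M) ∧
          ∀ y ∈ A, ∀ i ≤ m,
            χ (y * initialDiag (m + 1) (i + 1) (decreasingProd x F)) = c := by
      induction k with
      | zero =>
        obtain ⟨A, hA⟩ := hW.nonempty
        exact ⟨∅, rfl, N, le_rfl, A, hA, by simp⟩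
      | succ k ihk =>
        obtain ⟨C, hC, M, hM, A, hA, hAC⟩ := ihk
        obtain ⟨c₀, B, hB, hBA, hBc⟩ := hW.exists_monochromatic hA χ
        have hc₀ : c₀ ∉ C := by
          intro hmem
          obtain ⟨F, hF, hFN, hFA⟩ := hAC c₀ hmem
          obtain ⟨y, hy⟩ : B.Nonempty := by
            rw [Set.nonempty_iff_ne_empty]
            rintro rfl
            exact hW.empty_notMem hB
          refine hcon ⟨F, hF, fun n hn => (hFN n hn).1, c₀, y, fun i hi => ?_⟩
          rcases i with _ | i
          · rw [initialDiag_zero, mul_one, hBc y hy]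
          · exact hFA y (hBA hy) i (by omega)
        obtain ⟨E, hE, hEM, hEW⟩ := hW.exists_vertices_mem x ih hB M
        refine ⟨insert c₀ C, by rw [Finset.card_insert_of_notMem hc₀, hC],
          max M (E.sup id + 1), le_max_of_le_left hM, _, hEW, fun c hc => ?_⟩
        have hElt (n : ℕ) (hn : n ∈ E) : N ≤ n ∧ n < max M (E.sup id + 1) :=
          ⟨hM.trans (hEM n hn),
            lt_max_of_lt_right (Nat.lt_succ_of_le (Finset.le_sup (f := id) hn))⟩
        rcases Finset.mem_insert.1 hc with rfl | hc
        · exact ⟨E, hE, hElt, fun y hy i hi => hBc _ (hy i hi)⟩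
        · obtain ⟨F, hF, hFN, hFA⟩ := hAC c hc
          refine ⟨F ∪ E, hF.mono Finset.subset_union_left, fun n hn => ?_, fun y hy i hi => ?_⟩
          · rcases Finset.mem_union.1 hn with hn | hn
            · exact ⟨(hFN n hn).1, lt_max_of_lt_left (hFN n hn).2⟩
            · exact hElt n hn
          · rw [decreasingProd_union x fun a ha b hb => (hFN a ha).2.trans_le (hEM b hb),
              initialDiag_mul, ← mul_assoc]
            exact hFA _ (hBA (hy i hi)) i hi
    obtain ⟨C, hC, -⟩ := focus (Fintype.card κ + 1)
    have := C.card_le_univ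
    omega

theorem IsRightVdWGroup.isLeftIPStar_D (hG : IsRightVdWGroup G) {m r : ℕ}
    (χ : (Fin m → G) → Fin r) : IsLeftIPStar (D m χ) := by
  rintro Y ⟨x, hx⟩
  obtain ⟨F, hF, -, c, y, hy⟩ := hG.exists_monochromatic_corner x m (Fin r) χ 0
  exact ⟨decreasingProd x F,
    (mem_D_iff χ _).2 ⟨c, y, hy⟩, hx ⟨F, hF, rfl⟩⟩

/-- The anti-isomorphism from `G^m` onto `(Gᵐᵒᵖ)^m`. -/
def powOpEquiv (G : Type*) (m : ℕ) : (Fin m → G) ≃ (Fin m → Gᵐᵒᵖ) :=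
  Equiv.piCongrRight fun _ => MulOpposite.opEquiv

theorem IsLeftVdWGroup.isRightVdWGroup_op (hG : IsLeftVdWGroup G) : IsRightVdWGroup Gᵐᵒᵖ := by
  intro m hm
  obtain ⟨W, hW⟩ := hG m hm
  exact ⟨_, hW.hasRightVdW_of_antiEquiv (powOpEquiv G m) fun a b => rfl⟩

theorem IsLeftVdWGroup.isRightIPStar_S (hG : IsLeftVdWGroup G) {m r : ℕ}
    (χ : (Fin m → G) → Fin r) : IsRightIPStar (S m χ) := by
  rintro Y ⟨x, hx⟩
  obtain ⟨g, hg, F, hF, rfl⟩ := hG.isRightVdWGroup_op.isLeftIPStar_D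
    (fun y => χ ((powOpEquiv G m).symm y)) (FPL fun n => MulOpposite.op (x n)) ⟨_, subset_rfl⟩
  obtain ⟨c, y, hy⟩ := (mem_D_iff _ _).1 hg
  have hprod : (((F.sort (· ≤ ·)).reverse.map fun n => MulOpposite.op (x n)).prod)
      = MulOpposite.op ((F.sort (· ≤ ·)).map x).prod := by
    rw [MulOpposite.op_list_prod, List.map_map, List.map_reverse]
    rfl
  rw [hprod] at hy
  refine ⟨_, (mem_S_iff χ _).2 ⟨c, (powOpEquiv G m).symm y, fun i hi => ?_⟩, hx ⟨F, hF, rfl⟩⟩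
  rw [← hy i hi]
  congr 1
  funext j
  by_cases hj : (j : ℕ) < i <;> simp [powOpEquiv, initialDiag, hj]

end MonochromaticCorners

end VanDerWaerden

theorem mainTheorem10 {G : Type*} [Group G] [Countable G]
    (hG : VanDerWaerden.IsAmenable G) (m : ℕ) (hm : 1 ≤ m) (r : ℕ)
    (χ : (Fin m → G) → Fin r) :
    (VanDerWaerden.IsRightVdWGroup G → VanDerWaerden.IsLeftIPStar (VanDerWaerden.D m χ)) ∧
      (VanDerWaerden.IsLeftVdWGroup G → VanDerWaerden.IsRightIPStar (VanDerWaerden.S m χ)) := by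
  exact ⟨fun h => h.isLeftIPStar_D χ, fun h => h.isRightIPStar_S χ⟩
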